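/- For $1<p<\infty$ let $X^p(\mathbb{R}_+)$ be the space of measurable functions $f:\mathbb{R}_+\to\mathbb{C}$, $\mathbb{R}_+=(0,\infty)$, with $\|f\|_{X^p}=\left(\int_0^\infty |f(x)|^p\,\frac{dx}{x}\right)^{1/p}<\infty$ (functions equal almost everywhere being identified), and let $\Theta=x\frac{d}{dx}$ be the infinitesimal generator of the group $U(t)f(x)=f(e^t x)$, $t\in\mathbb{R}$, in $X^p(\mathbb{R}_+)$, i.e. $\Theta f=\lim_{t\to0}(U(t)f-f)/t$ in the norm of $X^p(\mathbb{R}_+)$. For $\sigma>0$ the Bernstein space $\mathbf{B}_\sigma^p(\Theta)$ is the set of all $f\in X^p(\mathbb{R}_+)$ that belong to the domain of every power $\Theta^k$ and satisfy $\|\Theta^k f\|_{X^p}\le\sigma^k\|f\|_{X^p}$ for all $k\in\mathbb{N}$. Put $\operatorname{sinc}(u)=\frac{\sin \pi u}{\pi u}$ for $u\ne0$ and $\operatorname{sinc}(0)=1$. Theorem. Let $\sigma>0$, $1<p<\infty$ and $f\in\mathbf{B}_\sigma^p(\Theta)$. Then $f$ has a continuous representative on $\mathbb{R}_+$, which is infinitely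 differentiable; denoting it again by $f$, for all $\tau\in\mathbb{R}_+$ $$f(\tau)=\operatorname{sinc}\left(\frac{\sigma}{\pi}\ln\tau\right)f(1)+\ln\tau\,\operatorname{sinc}\left(\frac{\sigma}{\pi}\ln\tau\right)(\partial_x f)(1)+\sum_{k\in\mathbb{Z}\setminus\{0\}}f\left(e^{k\pi/\sigma}\right)\frac{\sigma}{k\pi}\,(\ln\tau)\,\operatorname{sinc}\left(\frac{\sigma}{\pi}\ln\tau-k\right).$$ The series converges absolutely, and it and the series of the absolute values of its terms converge uniformly on compact subsets of $\mathbb{R}_+$. -/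

import Mathlib

open MeasureTheory Set Filter Topology
open scoped ENNReal ContDiff

noncomputable section

namespace Mellin

/-- Lebesgue measure on the half-line `(0, ∞)`. A function on the half-line is represented by a
function `ℝ → ℂ` whose values off `(0, ∞)` are irrelevant. -/
def halfLine : Measure ℝ := volume.restrict (Ioi 0)

/-- `x ↦ x ^ (-1/p) * f x`. -/
def weighted (p : ℝ) (f : ℝ → ℂ) : ℝ → ℂ := fun x => ((x ^ (-1 / p) : ℝ) : ℂ) * f x

/-- `f` belongs to `X^p(0, ∞)`, for finite `p`. -/
def MemX (p : ℝ) (f : ℝ → ℂ) : Prop := MemLp (weighted p f) (ENNReal.ofReal p) halfLine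

/-- The norm of `X^p(0, ∞)`, for finite `p`, with values in `[0, ∞]`. -/
def xNorm (p : ℝ) (f : ℝ → ℂ) : ℝ≥0∞ := eLpNorm (weighted p f) (ENNReal.ofReal p) halfLine

/-- The Mellin translation `(U(t) f)(x) = f (e^t x)`. -/
def translate (t : ℝ) (f : ℝ → ℂ) : ℝ → ℂ := fun x => f (Real.exp t * x)

/-- `f` lies in the domain of the infinitesimal generator `Θ = x d/dx` of the group `U(t)` on
`X^p(0, ∞)`, and `Θ f = g` (as elements of that space, i.e. almost everywhere):
the difference quotients `(U(t) f - f) / t` tend to `g` in the norm of `X^p` as `t → 0`. -/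
def IsTheta (p : ℝ) (f g : ℝ → ℂ) : Prop :=
  MemX p f ∧ MemX p g ∧
    Tendsto (fun t : ℝ => xNorm p (fun x => (translate t f x - f x) / (t : ℂ) - g x))
      (𝓝[≠] 0) (𝓝 0)

/-- The Bernstein space `B_σ^p(Θ)`: all `f` in the domain of every power of `Θ` such that
`‖Θ^k f‖ ≤ σ^k ‖f‖` for all `k`. The function `g k` is `Θ^k f`, which is unique up to
almost everywhere equality. -/
def bernstein (σ p : ℝ) : Set (ℝ → ℂ) :=
  {f | ∃ g : ℕ → ℝ → ℂ, g 0 = f ∧ (∀ k, IsTheta p (g k) (g (k + 1))) ∧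
    ∀ k, xNorm p (g k) ≤ ENNReal.ofReal (σ ^ k) * xNorm p f}

/-- The normalized cardinal sine: `sin (π x) / (π x)`, with value `1` at `0`. -/
def nsinc (x : ℝ) : ℝ := Real.sinc (Real.pi * x)

/-- The term of index `k ≠ 0` of the sampling series of `f`. -/
def vtTerm (σ : ℝ) (f : ℝ → ℂ) (k : {k : ℤ // k ≠ 0}) (τ : ℝ) : ℂ :=
  f (Real.exp ((k : ℤ) * Real.pi / σ)) *
    ((σ / ((k : ℤ) * Real.pi) * Real.log τ *
      nsinc (σ / Real.pi * Real.log τ - (k : ℤ)) : ℝ) : ℂ)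

end Mellin

end

/-!
In the variable `t = log x` the operator `Θ` is `d/dt`, so `h t = f (exp t)` is smooth and lies in
`L^p(ℝ)`, with `‖h⁽ᵏ⁾‖ ≤ σ ^ k ‖h‖`. As a point value is bounded by the `L^p` norms of the function
and of its derivative, `|h⁽ᵏ⁾|` is bounded by `M * σ ^ k` for a fixed `M`; rescale to `σ = π`.

If `h` is integrable with integrable derivatives, these bounds force its Fourier transform to vanish
outside `[-1/2, 1/2]`. On that interval `exp (2 π i t x) - 2 π i x * t * sinc t` takes equal values
at the endpoints, so its Fourier series converges absolutely. Its Fourier coefficients are the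
coefficients of the sampling series, and Fourier inversion gives
`h t - t * sinc t * h' 0 = ∑ k, samplingCoeff t k * h k`.

For bounded `h`, apply this to `φ ((1 - r) * t) * h (r * t)`, where `φ` is an integrable function of
exponential type with `φ 0 = 1`, and let `r` tend to `1` from below. The coefficients are summable,
so the limit may be taken termwise.
-/

namespace Mellin

open scoped FourierTransform

section ExpType

variable {E : Type*} [NormedAddCommGroup E]

/-- `u` is smooth and its `k`-th derivative is bounded by `a ^ k` times a weight `w` that does not
depend on `k`. For bounded `w` this is Bernstein's description of the functions of exponential type
`a` that are bounded on the line; an integrable `w` encodes decay. -/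
structure ExpTypeBound [NormedSpace ℝ E] (a : ℝ) (w : ℝ → ℝ) (u : ℝ → E) : Prop where
  contDiff : ContDiff ℝ ∞ u
  norm_iteratedDeriv_le : ∀ k t, ‖iteratedDeriv k u t‖ ≤ a ^ k * w t

section Real

variable [NormedSpace ℝ E] {a c : ℝ} {w : ℝ → ℝ} {u : ℝ → E} {v : ℕ → ℝ → E}

theorem iteratedDeriv_eq_of_hasDerivAt (hv : ∀ k t, HasDerivAt (v k) (v (k + 1) t) t) (k : ℕ) :
    iteratedDeriv k (v 0) = v k := by
  induction k with
  | zero => exact iteratedDeriv_zero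
  | succ k ih => rw [iteratedDeriv_succ, ih, funext fun t => (hv k t).deriv]

theorem contDiff_of_hasDerivAt (hv : ∀ k t, HasDerivAt (v k) (v (k + 1) t) t) :
    ContDiff ℝ ∞ (v 0) := by
  refine contDiff_of_differentiable_iteratedDeriv fun m _ => ?_
  rw [iteratedDeriv_eq_of_hasDerivAt hv]
  exact fun t => (hv m t).differentiableAt

theorem ExpTypeBound.of_hasDerivAt (hv : ∀ k t, HasDerivAt (v k) (v (k + 1) t) t)
    (hle : ∀ k t, ‖v k t‖ ≤ a ^ k * w t) : ExpTypeBound a w (v 0) where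
  contDiff := contDiff_of_hasDerivAt hv
  norm_iteratedDeriv_le k := by simpa only [iteratedDeriv_eq_of_hasDerivAt hv] using hle k

theorem ExpTypeBound.norm_le (hu : ExpTypeBound a w u) (t : ℝ) : ‖u t‖ ≤ w t := by
  simpa using hu.norm_iteratedDeriv_le 0 t

theorem ExpTypeBound.differentiable (hu : ExpTypeBound a w u) : Differentiable ℝ u :=
  hu.contDiff.differentiable (by simp)

theorem ExpTypeBound.comp_const_mul (hu : ExpTypeBound a w u) (hc : 0 ≤ c) :
    ExpTypeBound (c * a) (fun t => w (c * t)) (fun t => u (c * t)) := by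
  refine ⟨hu.contDiff.comp (by fun_prop), fun k t => ?_⟩
  rw [iteratedDeriv_comp_const_smul (hu.contDiff.of_le (mod_cast le_top)), norm_smul, norm_pow,
    Real.norm_of_nonneg hc, mul_pow, mul_assoc]
  exact mul_le_mul_of_nonneg_left (hu.norm_iteratedDeriv_le k _) (by positivity)

theorem ExpTypeBound.integrable_iteratedDeriv (hu : ExpTypeBound a w u) (hw : Integrable w)
    (k : ℕ) : Integrable (iteratedDeriv k u) :=
  (hw.const_mul (a ^ k)).mono'
    (hu.contDiff.continuous_iteratedDeriv k (mod_cast le_top)).aestronglyMeasurable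
    (Eventually.of_forall (hu.norm_iteratedDeriv_le k))

end Real

variable [NormedSpace ℂ E] {a b : ℝ} {w z : ℝ → ℝ} {u : ℝ → E} {φ : ℝ → ℂ}

theorem ExpTypeBound.smul (ha : 0 ≤ a) (hφ : ExpTypeBound a w φ) (hu : ExpTypeBound b z u) :
    ExpTypeBound (a + b) (fun t => w t * z t) (fun t => φ t • u t) := by
  refine ⟨hφ.contDiff.smul hu.contDiff, fun k t => ?_⟩
  have hw : 0 ≤ w t := (norm_nonneg _).trans (hφ.norm_le t)
  rw [← norm_iteratedFDeriv_eq_norm_iteratedDeriv, add_pow, Finset.sum_mul]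
  refine (norm_iteratedFDeriv_smul_le hφ.contDiff hu.contDiff t (mod_cast le_top)).trans
    (Finset.sum_le_sum fun i _ => ?_)
  simp only [norm_iteratedFDeriv_eq_norm_iteratedDeriv]
  calc (k.choose i : ℝ) * ‖iteratedDeriv i φ t‖ * ‖iteratedDeriv (k - i) u t‖
      ≤ k.choose i * (a ^ i * w t) * (b ^ (k - i) * z t) := by
        gcongr
        · exact hφ.norm_iteratedDeriv_le i t
        · exact hu.norm_iteratedDeriv_le (k - i) t
    _ = a ^ i * b ^ (k - i) * k.choose i * (w t * z t) := by ring

theorem ExpTypeBound.pow_mul_norm_fourier_le (hu : ExpTypeBound a w u) (hw : Integrable w)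
    (k : ℕ) (ξ : ℝ) :
    (2 * Real.pi * |ξ|) ^ k * ‖𝓕 u ξ‖ ≤ a ^ k * ∫ t, w t := by
  have hi := hu.integrable_iteratedDeriv hw
  calc (2 * Real.pi * |ξ|) ^ k * ‖𝓕 u ξ‖ = ‖𝓕 (iteratedDeriv k u) ξ‖ := by
        rw [Real.fourier_iteratedDeriv (N := ⊤) hu.contDiff (fun n _ => hi n) le_top, norm_smul,
          norm_pow]
        simp [abs_of_pos Real.pi_pos]
    _ ≤ ∫ t, ‖iteratedDeriv k u t‖ := VectorFourier.norm_fourierIntegral_le_integral_norm _ _ _ _ _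
    _ ≤ ∫ t, a ^ k * w t :=
        integral_mono (hi k).norm (hw.const_mul _) (hu.norm_iteratedDeriv_le k)
    _ = a ^ k * ∫ t, w t := integral_const_mul _ _

theorem ExpTypeBound.fourier_eq_zero (hu : ExpTypeBound a w u) (hw : Integrable w) (ha : 0 ≤ a)
    {ξ : ℝ} (hξ : a < 2 * Real.pi * |ξ|) : 𝓕 u ξ = 0 := by
  have hb : 0 < 2 * Real.pi * |ξ| := ha.trans_lt hξ
  have hle (k : ℕ) : ‖𝓕 u ξ‖ ≤ (a / (2 * Real.pi * |ξ|)) ^ k * ∫ t, w t := by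
    rw [div_pow, div_mul_eq_mul_div, le_div_iff₀' (by positivity)]
    exact hu.pow_mul_norm_fourier_le hw k ξ
  have hlim := (tendsto_pow_atTop_nhds_zero_of_lt_one (by positivity)
    ((div_lt_one hb).mpr hξ)).mul_const (∫ t, w t)
  rw [zero_mul] at hlim
  exact norm_le_zero_iff.mp (ge_of_tendsto' hlim hle)

end ExpType

section Multiplier

/-- The `j`-th derivative of `t ↦ (exp (i t) - 1) / (i t)`, the singularity at `0` being removed by
writing this quotient as the mean of `exp (i x t)` over `x ∈ [0, 1]`. Its square is an integrable
function of exponential type when `j = 0`. -/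
noncomputable def expMean (j : ℕ) (t : ℝ) : ℂ :=
  ∫ x in (0 : ℝ)..1, (Complex.I * x) ^ j * Complex.exp (Complex.I * x * t)

theorem norm_exp_I_mul_mul (x t : ℝ) : ‖Complex.exp (Complex.I * x * t)‖ = 1 := by
  simpa [mul_assoc] using Complex.norm_exp_I_mul_ofReal (x * t)

theorem norm_pow_mul_exp_le_one (j : ℕ) (t : ℝ) {x : ℝ} (hx : x ∈ uIcc (0 : ℝ) 1) :
    ‖(Complex.I * x) ^ j * Complex.exp (Complex.I * x * t)‖ ≤ 1 := by
  rw [uIcc_of_le zero_le_one] at hx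
  rw [norm_mul, norm_exp_I_mul_mul, mul_one, norm_pow, norm_mul, Complex.norm_I, one_mul,
    Complex.norm_real, Real.norm_of_nonneg hx.1]
  exact pow_le_one₀ hx.1 hx.2

theorem norm_expMean_le_one (j : ℕ) (t : ℝ) : ‖expMean j t‖ ≤ 1 := by
  simpa [expMean] using intervalIntegral.norm_integral_le_of_norm_le_const
    (fun x hx => norm_pow_mul_exp_le_one j t (uIoc_subset_uIcc hx))

theorem expMean_zero_zero : expMean 0 0 = 1 := by simp [expMean]

theorem hasDerivAt_expMean (j : ℕ) (t : ℝ) : HasDerivAt (expMean j) (expMean (j + 1) t) t := by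
  have hmeas (j : ℕ) (s : ℝ) : Continuous fun x : ℝ =>
      (Complex.I * x) ^ j * Complex.exp (Complex.I * x * s) := by fun_prop
  refine (intervalIntegral.hasDerivAt_integral_of_dominated_loc_of_deriv_le univ_mem
    (Eventually.of_forall fun s => (hmeas j s).aestronglyMeasurable)
    ((hmeas j t).intervalIntegrable _ _) (hmeas (j + 1) t).aestronglyMeasurable
    (Eventually.of_forall fun x hx s _ =>
      norm_pow_mul_exp_le_one (j + 1) s (uIoc_subset_uIcc hx))
    intervalIntegrable_const (Eventually.of_forall fun x _ s _ => ?_)).2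
  refine ((((hasDerivAt_id s).ofReal_comp.const_mul (Complex.I * x)).cexp).const_mul
    ((Complex.I * x) ^ j)).congr_deriv ?_
  simp only [id, Complex.ofReal_one]
  ring

theorem I_mul_mul_expMean (j : ℕ) (t : ℝ) :
    Complex.I * t * expMean j t = Complex.I ^ j * Complex.exp (Complex.I * t)
      - 0 ^ j - j * Complex.I * expMean (j - 1) t := by
  have hpow (x : ℝ) : HasDerivAt (fun x : ℝ => (Complex.I * x) ^ j)
      (j * (Complex.I * x) ^ (j - 1) * Complex.I) x := by
    have := ((hasDerivAt_id x).ofReal_comp.const_mul Complex.I).fun_pow j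
    simp only [id, Complex.ofReal_one, mul_one] at this
    exact this
  have hexp (x : ℝ) : HasDerivAt (fun x : ℝ => Complex.exp (Complex.I * x * t))
      (Complex.exp (Complex.I * x * t) * (Complex.I * t)) x := by
    simpa using (((hasDerivAt_id x).ofReal_comp.const_mul Complex.I).mul_const (t : ℂ)).cexp
  have hparts := intervalIntegral.integral_mul_deriv_eq_deriv_mul (a := 0) (b := 1)
    (fun x _ => hpow x) (fun x _ => hexp x)
    ((by fun_prop : Continuous _).intervalIntegrable _ _)
    ((by fun_prop : Continuous _).intervalIntegrable _ _)
  simp only [expMean, ← intervalIntegral.integral_const_mul]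
  convert hparts using 2
  · congr with x
    ring
  · simp
  · congr with x
    ring

theorem abs_mul_norm_expMean_le (j : ℕ) (t : ℝ) : |t| * ‖expMean j t‖ ≤ j + 2 := by
  have hzero : ‖(0 : ℂ) ^ j‖ ≤ 1 := by
    rw [norm_pow, norm_zero]
    exact pow_le_one₀ le_rfl zero_le_one
  calc |t| * ‖expMean j t‖ = ‖Complex.I * t * expMean j t‖ := by simp
    _ ≤ 1 + 1 + j * 1 := by
        rw [I_mul_mul_expMean]
        refine (norm_sub_le _ _).trans (add_le_add ((norm_sub_le _ _).trans ?_) ?_)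
        · simpa [Complex.norm_exp_I_mul_ofReal] using hzero
        · simpa using mul_le_of_le_one_right j.cast_nonneg (norm_expMean_le_one (j - 1) t)
    _ = j + 2 := by ring

theorem expTypeBound_expMean : ExpTypeBound 2 (fun t => 3 / (1 + |t|)) (expMean 0) := by
  refine .of_hasDerivAt hasDerivAt_expMean fun k t => ?_
  have hk : (k : ℝ) + 1 ≤ 2 ^ k := mod_cast Nat.lt_two_pow_self
  rw [← mul_div_assoc, le_div_iff₀ (by positivity)]
  linarith [norm_expMean_le_one k t, abs_mul_norm_expMean_le k t, (k.cast_nonneg : (0 : ℝ) ≤ k)]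

theorem integrable_inv_one_add_abs_sq : Integrable fun t : ℝ => ((1 + |t|) ^ 2)⁻¹ := by
  refine integrable_inv_one_add_sq.mono' (by fun_prop) (Eventually.of_forall fun t => ?_)
  rw [Real.norm_of_nonneg (by positivity)]
  gcongr
  nlinarith [abs_nonneg t, sq_abs t]

theorem exists_integrable_expTypeBound_one :
    ∃ (φ : ℝ → ℂ) (w : ℝ → ℝ), ExpTypeBound 1 w φ ∧ Integrable w ∧ φ 0 = 1 ∧ ∀ t, ‖φ t‖ ≤ 1 := by
  have hs : ExpTypeBound (1 / 2) (fun t => 3 / (1 + |1 / 4 * t|))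
      (fun t => expMean 0 (1 / 4 * t)) := by
    convert expTypeBound_expMean.comp_const_mul (c := 1 / 4) (by norm_num) using 1
    norm_num
  have hφ := hs.smul (by norm_num) hs
  rw [add_halves] at hφ
  refine ⟨_, _, hφ, ?_, by simp [expMean_zero_zero], fun t => ?_⟩
  · refine ((integrable_inv_one_add_abs_sq.comp_mul_left' (R := 1 / 4) (by norm_num)).const_mul
      9).congr (Eventually.of_forall fun t => ?_)
    field_simp
    norm_num
  · rw [norm_smul]
    exact mul_le_one₀ (norm_expMean_le_one _ _) (norm_nonneg _) (norm_expMean_le_one _ _)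

end Multiplier

section SamplingCoefficients

theorem mul_nsinc (x : ℝ) : x * nsinc x = Real.sin (Real.pi * x) / Real.pi := by
  rcases eq_or_ne x 0 with rfl | hx
  · simp
  · rw [nsinc, Real.sinc_of_ne_zero (mul_ne_zero Real.pi_ne_zero hx)]
    field_simp

theorem abs_nsinc_le_one (x : ℝ) : |nsinc x| ≤ 1 := Real.abs_sinc_le_one _

theorem abs_mul_nsinc_le_one (x : ℝ) : |x * nsinc x| ≤ 1 := by
  rw [mul_nsinc, abs_div, abs_of_pos Real.pi_pos, div_le_one Real.pi_pos]
  exact (Real.abs_sin_le_one _).trans (by linarith [Real.pi_gt_three])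

theorem nsinc_zero_sub_intCast {n : ℤ} (hn : n ≠ 0) : nsinc (0 - n) = 0 := by
  have h := mul_nsinc (0 - n)
  rw [zero_sub, mul_neg, Real.sin_neg, mul_comm Real.pi, Real.sin_int_mul_pi, neg_zero, zero_div]
    at h
  simpa [hn] using h

theorem abs_div_mul_nsinc_sub_le (t : ℝ) {k : ℝ} (hk : k ≠ 0) :
    |t / k * nsinc (t - k)| ≤ |t| * (1 + |t|) * (1 / k ^ 2) := by
  have hdecay : |k * nsinc (t - k)| ≤ 1 + |t| := by
    calc |k * nsinc (t - k)| = |t * nsinc (t - k) - (t - k) * nsinc (t - k)| := by ring_nf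
      _ ≤ |t| * |nsinc (t - k)| + |(t - k) * nsinc (t - k)| :=
          (abs_sub _ _).trans_eq (by rw [abs_mul t])
      _ ≤ |t| * 1 + 1 := by
          gcongr
          exacts [abs_nsinc_le_one _, abs_mul_nsinc_le_one _]
      _ = 1 + |t| := by ring
  calc |t / k * nsinc (t - k)| = |t| * |k * nsinc (t - k)| * (1 / k ^ 2) := by
        rw [abs_mul, abs_mul, abs_div, ← sq_abs k]
        field_simp
    _ ≤ |t| * (1 + |t|) * (1 / k ^ 2) := by gcongr

/-- The coefficient of the sample at `k` in the derivative sampling series on the integers. -/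
noncomputable def samplingCoeff (t : ℝ) (k : ℤ) : ℝ :=
  if k = 0 then nsinc t else t / k * nsinc (t - k)

theorem samplingCoeff_zero (t : ℝ) : samplingCoeff t 0 = nsinc t := if_pos rfl

theorem samplingCoeff_of_ne_zero (t : ℝ) {k : ℤ} (hk : k ≠ 0) :
    samplingCoeff t k = t / k * nsinc (t - k) := if_neg hk

theorem summable_abs_samplingCoeff (t : ℝ) : Summable fun k => |samplingCoeff t k| := by
  refine Summable.of_norm_bounded_eventually
    ((Real.summable_one_div_int_pow.mpr one_lt_two).mul_left (|t| * (1 + |t|))) ?_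
  filter_upwards [eventually_cofinite_ne 0] with k hk
  rw [Real.norm_eq_abs, abs_abs, samplingCoeff_of_ne_zero t hk]
  exact abs_div_mul_nsinc_sub_le t (mod_cast hk)

theorem neg_half_lt_half : (-(1 / 2) : ℝ) < 1 / 2 := by norm_num

theorem integral_exp_eq_nsinc (s : ℝ) :
    ∫ x in (-(1 / 2) : ℝ)..(1 / 2), Complex.exp (2 * Real.pi * Complex.I * s * x) = nsinc s := by
  rcases eq_or_ne s 0 with rfl | hs
  · norm_num [nsinc]
  have h := intervalIntegral.smul_integral_comp_mul_left
    (a := -(1 / 2)) (b := 1 / 2) (fun x : ℝ => Complex.exp (x * Complex.I)) (2 * Real.pi * s)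
  rw [show 2 * Real.pi * s * (1 / 2) = Real.pi * s by ring,
    show 2 * Real.pi * s * -(1 / 2) = -(Real.pi * s) by ring, integral_exp_mul_I_eq_sinc] at h
  have hc : ((2 * Real.pi * s : ℝ) : ℂ) ≠ 0 := by simp [hs, Real.pi_ne_zero]
  refine mul_left_cancel₀ hc (Eq.trans ?_ (h.trans ?_))
  · rw [Complex.real_smul]
    congr 2 with x
    push_cast
    ring_nf
  · rw [nsinc]
    push_cast
    ring

theorem fourierCoeffOn_half_eq_integral (f : ℝ → ℂ) (n : ℤ) :
    fourierCoeffOn neg_half_lt_half f n =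
      ∫ x in (-(1 / 2) : ℝ)..(1 / 2), Complex.exp (-(2 * Real.pi * Complex.I * n * x)) * f x := by
  rw [fourierCoeffOn_eq_integral]
  simp only [fourier_coe_apply, smul_eq_mul]
  norm_num [neg_mul, neg_div]

theorem exp_neg_mul_exp (t x : ℝ) (n : ℤ) :
    Complex.exp (-(2 * Real.pi * Complex.I * n * x)) * Complex.exp (2 * Real.pi * Complex.I * t * x)
      = Complex.exp (2 * Real.pi * Complex.I * ((t - n : ℝ) : ℂ) * x) := by
  rw [← Complex.exp_add]
  push_cast
  ring_nf

/-- The function whose Fourier coefficients on `[-1/2, 1/2]` are `samplingCoeff t`. The linear term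
gives it equal values at the endpoints: its periodic extension is continuous, which makes the
coefficients summable. -/
noncomputable def samplingSymbol (t x : ℝ) : ℂ :=
  Complex.exp (2 * Real.pi * Complex.I * t * x)
    - (t * nsinc t : ℝ) * (2 * Real.pi * Complex.I * x)

theorem hasDerivAt_samplingSymbol (t x : ℝ) : HasDerivAt (samplingSymbol t)
    (2 * Real.pi * Complex.I * t *
      (Complex.exp (2 * Real.pi * Complex.I * t * x) - (nsinc t : ℂ))) x := by
  have hx := (hasDerivAt_id x).ofReal_comp
  refine ((hx.const_mul (2 * Real.pi * Complex.I * t)).cexp.sub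
    ((hx.const_mul (2 * Real.pi * Complex.I)).const_mul _)).congr_deriv ?_
  simp only [id, Complex.ofReal_one, Complex.ofReal_mul]
  ring

theorem samplingSymbol_neg_half (t : ℝ) :
    samplingSymbol t (-(1 / 2)) = samplingSymbol t (1 / 2) := by
  have hsin : Real.pi * ((t : ℂ) * nsinc t) = Complex.sin (Real.pi * t) := by
    rw [← Complex.ofReal_mul, mul_nsinc]
    push_cast
    field_simp
  have hexp (ε : ℂ) : 2 * Real.pi * Complex.I * t * ε = (ε * 2) * (Real.pi * t) * Complex.I := by
    ring
  rw [samplingSymbol, samplingSymbol, hexp, hexp, Complex.exp_mul_I, Complex.exp_mul_I]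
  simp only [Complex.ofReal_neg, Complex.ofReal_div, Complex.ofReal_mul, Complex.ofReal_one,
    Complex.ofReal_ofNat, neg_mul, div_mul_cancel₀ (1 : ℂ) two_ne_zero, one_mul, Complex.cos_neg,
    Complex.sin_neg]
  linear_combination 2 * Complex.I * hsin

theorem fourierCoeffOn_samplingSymbol (t : ℝ) (n : ℤ) :
    fourierCoeffOn neg_half_lt_half (samplingSymbol t) n = samplingCoeff t n := by
  rcases eq_or_ne n 0 with rfl | hn
  · have hodd : ∫ x in (-(1 / 2) : ℝ)..(1 / 2), (x : ℂ) = 0 := by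
      rw [intervalIntegral.integral_ofReal, integral_id]
      norm_num
    simp only [fourierCoeffOn_half_eq_integral, samplingCoeff_zero, samplingSymbol, Int.cast_zero,
      mul_zero, zero_mul, neg_zero, Complex.exp_zero, one_mul]
    rw [intervalIntegral.integral_sub ((by fun_prop : Continuous _).intervalIntegrable _ _)
      ((by fun_prop : Continuous _).intervalIntegrable _ _), integral_exp_eq_nsinc,
      intervalIntegral.integral_const_mul, intervalIntegral.integral_const_mul, hodd]
    ring
  have hderiv : fourierCoeffOn neg_half_lt_half
      (fun x : ℝ => Complex.exp (2 * Real.pi * Complex.I * t * x) - (nsinc t : ℂ)) n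
        = nsinc (t - n) := by
    have hconst := integral_exp_eq_nsinc (0 - n)
    simp only [nsinc_zero_sub_intCast hn, ← exp_neg_mul_exp] at hconst
    simp only [fourierCoeffOn_half_eq_integral, mul_sub, exp_neg_mul_exp]
    rw [intervalIntegral.integral_sub ((by fun_prop : Continuous _).intervalIntegrable _ _)
      ((by fun_prop : Continuous _).intervalIntegrable _ _), integral_exp_eq_nsinc]
    simpa using Or.inl hconst
  rw [fourierCoeffOn_of_hasDerivAt neg_half_lt_half hn
    (fun x _ => hasDerivAt_samplingSymbol t x)
    ((by fun_prop : Continuous _).intervalIntegrable _ _), fourierCoeffOn.const_mul, hderiv,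
    samplingSymbol_neg_half, sub_self, samplingCoeff_of_ne_zero t hn]
  have : (n : ℂ) ≠ 0 := mod_cast hn
  have := Complex.I_ne_zero
  push_cast
  field_simp
  ring

theorem hasSum_samplingSymbol (t : ℝ) {x : ℝ} (hx : |x| < 1 / 2) :
    HasSum (fun k : ℤ => (samplingCoeff t k : ℂ) * Complex.exp (2 * Real.pi * Complex.I * k * x))
      (samplingSymbol t x) := by
  have hends : samplingSymbol t (-(1 / 2)) = samplingSymbol t (-(1 / 2) + 1) := by
    rw [samplingSymbol_neg_half]
    norm_num
  have hsymbol : Continuous (samplingSymbol t) :=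
    continuous_iff_continuousAt.mpr fun x => (hasDerivAt_samplingSymbol t x).continuousAt
  let S : C(AddCircle (1 : ℝ), ℂ) := ⟨AddCircle.liftIco 1 (-(1 / 2)) (samplingSymbol t),
    AddCircle.liftIco_continuous hends hsymbol.continuousOn⟩
  have hcoeff (k : ℤ) : fourierCoeff S k = samplingCoeff t k := by
    rw [← fourierCoeffOn_samplingSymbol]
    refine (fourierCoeff_liftIco_eq _ k).trans ?_
    congr 1
    norm_num
  have hsum : Summable (fourierCoeff S) := by
    refine Summable.of_norm ?_
    simpa only [hcoeff, Complex.norm_real, Real.norm_eq_abs] using summable_abs_samplingCoeff t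
  have hmem : x ∈ Ico (-(1 / 2)) (-(1 / 2) + 1) :=
    ⟨(abs_lt.mp hx).1.le, by linarith [(abs_lt.mp hx).2]⟩
  have hSx : S (x : AddCircle (1 : ℝ)) = samplingSymbol t x :=
    AddCircle.liftIco_coe_apply (f := samplingSymbol t) hmem
  rw [← hSx]
  refine (has_pointwise_sum_fourier_series_of_summable hsum x).congr_fun fun k => ?_
  simp [hcoeff]

end SamplingCoefficients

section SamplingFormula

variable {E : Type*} [NormedAddCommGroup E] [NormedSpace ℂ E]

theorem integrable_of_continuous_of_eq_zero {F : Type*} [NormedAddCommGroup F] {A : ℝ → F} {R : ℝ}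
    (hA : Continuous A) (h0 : ∀ x, R ≤ |x| → A x = 0) : Integrable A := by
  refine hA.integrable_of_hasCompactSupport
    (HasCompactSupport.intro (isCompact_Icc (a := -R) (b := R)) fun x hx => h0 x ?_)
  by_contra h
  exact hx (abs_le.mp (not_le.mp h).le)

theorem norm_exp_two_pi_mul (s x : ℝ) : ‖Complex.exp (2 * Real.pi * Complex.I * s * x)‖ = 1 := by
  rw [show 2 * Real.pi * Complex.I * s * x = ((2 * Real.pi * s * x : ℝ) : ℂ) * Complex.I by
    push_cast; ring, Complex.norm_exp_ofReal_mul_I]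

theorem integrable_exp_smul {A : ℝ → E} (hA : Integrable A) (s : ℝ) :
    Integrable fun x : ℝ => Complex.exp (2 * Real.pi * Complex.I * s * x) • A x :=
  hA.bdd_smul 1 (by fun_prop : Continuous _).aestronglyMeasurable
    (Eventually.of_forall fun x => (norm_exp_two_pi_mul s x).le)

theorem hasSum_integral_samplingSymbol_smul {A : ℝ → E} (hA : Integrable A)
    (h0 : ∀ x, 1 / 2 ≤ |x| → A x = 0) (t : ℝ) :
    HasSum (fun k : ℤ => samplingCoeff t k •
        ∫ x : ℝ, Complex.exp (2 * Real.pi * Complex.I * (k : ℝ) * x) • A x)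
      (∫ x, samplingSymbol t x • A x) := by
  have hsumm : Summable fun k : ℤ => ∫ x : ℝ, ‖samplingCoeff t k •
      (Complex.exp (2 * Real.pi * Complex.I * (k : ℝ) * x) • A x)‖ := by
    simp only [norm_smul, norm_exp_two_pi_mul, one_mul, integral_const_mul, Real.norm_eq_abs]
    exact (summable_abs_samplingCoeff t).mul_right _
  have hpt (x : ℝ) : ∑' k : ℤ, samplingCoeff t k •
      (Complex.exp (2 * Real.pi * Complex.I * (k : ℝ) * x) • A x) = samplingSymbol t x • A x := by
    rcases lt_or_ge |x| (1 / 2) with hx | hx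
    · refine Eq.trans (tsum_congr fun k => ?_) ((hasSum_samplingSymbol t hx).smul_const _).tsum_eq
      rw [mul_smul, Complex.coe_smul, Complex.ofReal_intCast]
    · simp [h0 x hx]
  have h := hasSum_integral_of_summable_integral_norm
    (fun k : ℤ => (integrable_exp_smul hA k).smul (samplingCoeff t k)) hsumm
  simpa only [Pi.smul_apply, hpt, integral_smul] using h

/-- A multiple of a dilate of `v` that inherits the decay of `φ` when `r < 1`, and tends to
`φ 0 • v` as `r → 1`. -/
noncomputable def dampedDilate (φ : ℝ → ℂ) (v : ℝ → E) (r t : ℝ) : E := φ ((1 - r) * t) • v (r * t)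

variable {φ : ℝ → ℂ} {v : ℝ → E}

theorem deriv_dampedDilate_zero (hφ : Differentiable ℝ φ) (hv : Differentiable ℝ v) (r : ℝ) :
    deriv (dampedDilate φ v r) 0 = φ 0 • r • deriv v 0 + ((1 - r) • deriv φ 0) • v 0 := by
  have hφr : HasDerivAt (fun t => φ ((1 - r) * t)) ((1 - r) • deriv φ 0) 0 := by
    simpa only [deriv_comp_mul_left, mul_zero] using
      (show DifferentiableAt ℝ (fun t => φ ((1 - r) * t)) 0 by fun_prop).hasDerivAt
  have hvr : HasDerivAt (fun t => v (r * t)) (r • deriv v 0) 0 := by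
    simpa only [deriv_comp_mul_left, mul_zero] using
      (show DifferentiableAt ℝ (fun t => v (r * t)) 0 by fun_prop).hasDerivAt
  exact (hφr.smul hvr).deriv.trans (by simp only [mul_zero])

theorem tendsto_dampedDilate (hφ : Continuous φ) (hv : Continuous v) (hφ0 : φ 0 = 1) (t : ℝ) :
    Tendsto (fun r => dampedDilate φ v r t) (𝓝[<] 1) (𝓝 (v t)) := by
  have hc : Continuous fun r => dampedDilate φ v r t := by
    unfold dampedDilate
    fun_prop
  simpa [dampedDilate, hφ0] using (hc.tendsto 1).mono_left (nhdsWithin_le_nhds (s := Iio 1))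

theorem tendsto_deriv_dampedDilate_zero (hφ : Differentiable ℝ φ) (hv : Differentiable ℝ v)
    (hφ0 : φ 0 = 1) :
    Tendsto (fun r => deriv (dampedDilate φ v r) 0) (𝓝[<] 1) (𝓝 (deriv v 0)) := by
  simp only [deriv_dampedDilate_zero hφ hv, hφ0, one_smul]
  have hc : Continuous fun r : ℝ => r • deriv v 0 + ((1 - r) • deriv φ 0) • v 0 := by fun_prop
  simpa using (hc.tendsto 1).mono_left (nhdsWithin_le_nhds (s := Iio 1))

variable [CompleteSpace E]

theorem integral_exp_smul_fourier {g : ℝ → E} (hg : Continuous g) (hi : Integrable g)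
    (hi' : Integrable (𝓕 g)) (s : ℝ) :
    ∫ x : ℝ, Complex.exp (2 * Real.pi * Complex.I * s * x) • 𝓕 g x = g s := by
  conv_rhs => rw [← hg.fourierInv_fourier_eq hi hi', Real.fourierInv_eq']
  congr with x
  simp only [RCLike.inner_apply, conj_trivial]
  push_cast
  ring_nf

theorem integral_samplingSymbol_smul_fourier {g : ℝ → E} (hg : ContDiff ℝ 1 g)
    (hi : Integrable g) (hi' : Integrable (deriv g)) (hF : Integrable (𝓕 g))
    (hF' : Integrable (𝓕 (deriv g))) (t : ℝ) :
    ∫ x, samplingSymbol t x • 𝓕 g x = g t - (t * nsinc t) • deriv g 0 := by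
  have hd : 𝓕 (deriv g) = fun x : ℝ => (2 * Real.pi * Complex.I * x) • 𝓕 g x :=
    Real.fourier_deriv hi (hg.differentiable one_ne_zero) hi'
  have hinv := integral_exp_smul_fourier (hg.continuous_deriv le_rfl) hi' hF' 0
  simp only [Complex.ofReal_zero, mul_zero, zero_mul, Complex.exp_zero, one_smul] at hinv
  calc ∫ x, samplingSymbol t x • 𝓕 g x
      = ∫ x : ℝ, (Complex.exp (2 * Real.pi * Complex.I * t * x) • 𝓕 g x
          - (t * nsinc t) • 𝓕 (deriv g) x) := by
        simp only [samplingSymbol, sub_smul, mul_smul, Complex.coe_smul, hd]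
    _ = g t - (t * nsinc t) • deriv g 0 := by
        rw [integral_sub (integrable_exp_smul hF t) (hF'.fun_smul _), integral_smul, hinv,
          integral_exp_smul_fourier hg.continuous hi hF]

theorem hasSum_samplingCoeff_smul_of_fourier_eq_zero {g : ℝ → E} (hg : ContDiff ℝ 1 g)
    (hi : Integrable g) (hi' : Integrable (deriv g)) (h0 : ∀ x, 1 / 2 ≤ |x| → 𝓕 g x = 0) (t : ℝ) :
    HasSum (fun k : ℤ => samplingCoeff t k • g k) (g t - (t * nsinc t) • deriv g 0) := by
  have hcont {f : ℝ → E} (hf : Integrable f) : Continuous (𝓕 f) :=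
    VectorFourier.fourierIntegral_continuous Real.continuous_fourierChar
      (by exact continuous_inner) hf
  have hF : Integrable (𝓕 g) := integrable_of_continuous_of_eq_zero (hcont hi) h0
  have h0' (x : ℝ) (hx : 1 / 2 ≤ |x|) : 𝓕 (deriv g) x = 0 := by
    simp [Real.fourier_deriv hi (hg.differentiable one_ne_zero) hi', h0 x hx]
  have hF' : Integrable (𝓕 (deriv g)) := integrable_of_continuous_of_eq_zero (hcont hi') h0'
  have h := hasSum_integral_samplingSymbol_smul hF h0 t
  simpa only [integral_exp_smul_fourier hg.continuous hi hF,
    integral_samplingSymbol_smul_fourier hg hi hi' hF hF'] using h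

variable {M σ r : ℝ} {w : ℝ → ℝ}

theorem hasSum_samplingCoeff_smul_dampedDilate (hφ : ExpTypeBound 1 w φ) (hw : Integrable w)
    (hv : ExpTypeBound Real.pi (fun _ => M) v) (hr : r ∈ Ioo 0 1) (t : ℝ) :
    HasSum (fun k : ℤ => samplingCoeff t k • dampedDilate φ v r k)
      (dampedDilate φ v r t - (t * nsinc t) • deriv (dampedDilate φ v r) 0) := by
  have hr' : 0 < 1 - r := sub_pos.mpr hr.2
  have hpi := Real.pi_gt_three
  have htype : (1 - r) * 1 + r * Real.pi < Real.pi := by nlinarith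
  have hg : ExpTypeBound ((1 - r) * 1 + r * Real.pi) _ (dampedDilate φ v r) :=
    (hφ.comp_const_mul hr'.le).smul (by positivity) (hv.comp_const_mul hr.1.le)
  have hw' : Integrable fun t => w ((1 - r) * t) * M := (hw.comp_mul_left' hr'.ne').mul_const M
  have hi := hg.integrable_iteratedDeriv hw'
  refine hasSum_samplingCoeff_smul_of_fourier_eq_zero (hg.contDiff.of_le (mod_cast le_top))
    (by simpa using hi 0) (by simpa using hi 1) (fun x hx => ?_) t
  refine hg.fourier_eq_zero hw' (by nlinarith [hr.1]) (htype.trans_le ?_)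
  nlinarith

/-- A merely bounded `v` has a Fourier transform only as a distribution, so the formula is obtained
as the limit of those for the damped dilates. -/
theorem ExpTypeBound.hasSum_samplingCoeff_smul (hv : ExpTypeBound Real.pi (fun _ => M) v) (t : ℝ) :
    HasSum (fun k : ℤ => samplingCoeff t k • v k) (v t - (t * nsinc t) • deriv v 0) := by
  obtain ⟨φ, w, hφ, hw, hφ0, hφ1⟩ := exists_integrable_expTypeBound_one
  have hsum : Summable fun k : ℤ => |samplingCoeff t k| * M :=
    (summable_abs_samplingCoeff t).mul_right M
  have hterm {c : ℝ} {y : E} (hy : ‖y‖ ≤ M) : ‖c • y‖ ≤ |c| * M := by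
    rw [norm_smul, Real.norm_eq_abs]
    gcongr
  have hdamped (r s : ℝ) : ‖dampedDilate φ v r s‖ ≤ M := by
    rw [dampedDilate, norm_smul]
    exact (mul_le_of_le_one_left (norm_nonneg _) (hφ1 _)).trans (hv.norm_le _)
  have hlim (s : ℝ) := tendsto_dampedDilate hφ.differentiable.continuous
    hv.differentiable.continuous hφ0 s
  have hleft := tendsto_tsum_of_dominated_convergence hsum
    (fun k : ℤ => (hlim k).const_smul (samplingCoeff t k))
    (Eventually.of_forall fun r k => hterm (hdamped r k))
  have hright := (hlim t).sub ((tendsto_deriv_dampedDilate_zero hφ.differentiable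
    hv.differentiable hφ0).const_smul (t * nsinc t))
  have heq : ∀ᶠ r : ℝ in 𝓝[<] 1, ∑' k : ℤ, samplingCoeff t k • dampedDilate φ v r k
      = dampedDilate φ v r t - (t * nsinc t) • deriv (dampedDilate φ v r) 0 := by
    filter_upwards [Ioo_mem_nhdsLT (zero_lt_one' ℝ)] with r hr
    exact (hasSum_samplingCoeff_smul_dampedDilate hφ hw hv hr t).tsum_eq
  rw [← tendsto_nhds_unique (hleft.congr' heq) hright]
  exact (Summable.of_norm_bounded hsum fun k => hterm (hv.norm_le k)).hasSum

theorem ExpTypeBound.hasSum_samplingCoeff_smul_of_pos (hσ : 0 < σ)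
    (hv : ExpTypeBound σ (fun _ => M) v) (t : ℝ) :
    HasSum (fun k : ℤ => samplingCoeff (σ / Real.pi * t) k • v (k * Real.pi / σ))
      (v t - (t * nsinc (σ / Real.pi * t)) • deriv v 0) := by
  have hscaled : ExpTypeBound Real.pi (fun _ => M) fun s => v (Real.pi / σ * s) := by
    simpa only [div_mul_cancel₀ Real.pi hσ.ne'] using
      hv.comp_const_mul (div_pos Real.pi_pos hσ).le
  have hinv : Real.pi / σ * (σ / Real.pi * t) = t := by field_simp
  have hderiv (c : ℝ) :
      (σ / Real.pi * t * c) • (Real.pi / σ) • deriv v 0 = (t * c) • deriv v 0 := by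
    rw [smul_smul]
    congr 1
    field_simp
  have hsample (k : ℤ) : Real.pi / σ * k = k * Real.pi / σ := by ring
  simpa only [hinv, hsample, deriv_comp_mul_left, mul_zero, hderiv] using
    hscaled.hasSum_samplingCoeff_smul (σ / Real.pi * t)

end SamplingFormula

section LpDerivative

variable {E : Type*} [NormedAddCommGroup E] {p : ℝ≥0∞} {a b : ℝ}

theorem lintegral_uIoc_enorm_le_eLpNorm (hp : 1 ≤ p) {f : ℝ → E} (hf : AEStronglyMeasurable f)
    (a b : ℝ) :
    ∫⁻ x in uIoc a b, ‖f x‖ₑ ≤ eLpNorm f p * ENNReal.ofReal |b - a| ^ (1 - 1 / p.toReal) := by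
  have h := eLpNorm_le_eLpNorm_mul_rpow_measure_univ hp (hf.restrict (s := uIoc a b))
  rw [eLpNorm_one_eq_lintegral_enorm, Measure.restrict_apply_univ, Real.volume_uIoc,
    ENNReal.toReal_one, div_one] at h
  exact h.trans (by gcongr; exact Measure.restrict_le_self)

theorem intervalIntegrable_of_locallyIntegrable {f : ℝ → E}
    (hf : LocallyIntegrable f) (a b : ℝ) :
    IntervalIntegrable f volume a b :=
  intervalIntegrable_iff.mpr ((hf.integrableOn_isCompact isCompact_uIcc).mono_set uIoc_subset_uIcc)

variable [NormedSpace ℝ E]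

theorem tendsto_intervalIntegral_of_tendsto_eLpNorm {ι : Type*} {l : Filter ι} {f : ι → ℝ → E}
    (hp : 1 ≤ p) (hf : ∀ i, AEStronglyMeasurable (f i))
    (h : Tendsto (fun i => eLpNorm (f i) p) l (𝓝 0)) (a b : ℝ) :
    Tendsto (fun i => ∫ x in a..b, f i x) l (𝓝 0) := by
  have hexp : 0 ≤ 1 - 1 / p.toReal := by
    rcases eq_or_ne p ⊤ with rfl | hptop
    · simp
    · have : 1 ≤ p.toReal := by simpa using ENNReal.toReal_mono hptop hp
      simpa using inv_le_one_of_one_le₀ this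
  have hbound := ENNReal.Tendsto.mul_const h
    (Or.inr (ENNReal.rpow_ne_top_of_nonneg hexp (ENNReal.ofReal_ne_top (r := |b - a|))))
  rw [zero_mul] at hbound
  refine tendsto_zero_iff_enorm_tendsto_zero.mpr (tendsto_of_tendsto_of_tendsto_of_le_of_le
    tendsto_const_nhds hbound (fun _ => zero_le) fun i => ?_)
  calc ‖∫ x in a..b, f i x‖ₑ = ‖∫ x in uIoc a b, f i x‖ₑ := by
        rw [← enorm_norm, intervalIntegral.norm_integral_eq_norm_integral_uIoc, enorm_norm]
    _ ≤ ∫⁻ x in uIoc a b, ‖f i x‖ₑ := enorm_integral_le_lintegral_enorm _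
    _ ≤ _ := lintegral_uIoc_enorm_le_eLpNorm hp (hf i) a b

/-- `u'` is the derivative of `u` in the norm of `L^p(ℝ)`, that is, the value at `u` of the
generator of the translation group of `L^p(ℝ)`. -/
structure HasLpDeriv (p : ℝ≥0∞) (u u' : ℝ → E) : Prop where
  memLp : MemLp u p
  memLp_deriv : MemLp u' p
  tendsto_eLpNorm : Tendsto (fun t : ℝ => eLpNorm (fun x => t⁻¹ • (u (t + x) - u x) - u' x) p)
    (𝓝[≠] 0) (𝓝 0)

variable {u u' : ℝ → E}

theorem HasLpDeriv.aestronglyMeasurable (h : HasLpDeriv p u u') (t : ℝ) :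
    AEStronglyMeasurable fun x => t⁻¹ • (u (t + x) - u x) - u' x := by
  have hshift : AEStronglyMeasurable fun x => u (t + x) :=
    h.memLp.1.comp_quasiMeasurePreserving (quasiMeasurePreserving_add_left volume t)
  exact ((hshift.sub h.memLp.1).const_smul t⁻¹).sub h.memLp_deriv.1

theorem HasLpDeriv.integral_smul_sub_sub (h : HasLpDeriv p u u') (hp : 1 ≤ p) (a b t : ℝ) :
    ∫ x in a..b, (t⁻¹ • (u (t + x) - u x) - u' x) =
      t⁻¹ • ((∫ s in 0..(b + t), u s) - ∫ s in 0..b, u s) -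
        t⁻¹ • ((∫ s in 0..(a + t), u s) - ∫ s in 0..a, u s) - ∫ x in a..b, u' x := by
  have hii := intervalIntegrable_of_locallyIntegrable (h.memLp.locallyIntegrable hp)
  have hii' := intervalIntegrable_of_locallyIntegrable (h.memLp_deriv.locallyIntegrable hp)
  have hshift : IntervalIntegrable (fun x => u (t + x)) volume a b := by
    simpa using (hii (t + a) (t + b)).comp_add_left t
  have hquot : IntervalIntegrable (fun x => t⁻¹ • (u (t + x) - u x)) volume a b :=
    (hshift.sub (hii a b)).smul t⁻¹
  rw [intervalIntegral.integral_sub hquot (hii' a b), intervalIntegral.integral_smul,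
    intervalIntegral.integral_sub hshift (hii a b),
    intervalIntegral.integral_comp_add_left u t, add_comm b t, add_comm a t,
    ← intervalIntegral.integral_interval_sub_left (hii 0 b) (hii 0 a),
    ← intervalIntegral.integral_interval_sub_left (hii 0 (t + b)) (hii 0 (t + a)), ← smul_sub]
  congr 2
  abel

theorem HasLpDeriv.sub_eq_integral (h : HasLpDeriv p u u') (hp : 1 ≤ p)
    (ha : HasDerivAt (fun x => ∫ s in 0..x, u s) (u a) a)
    (hb : HasDerivAt (fun x => ∫ s in 0..x, u s) (u b) b) : u b - u a = ∫ x in a..b, u' x := by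
  have hzero := tendsto_intervalIntegral_of_tendsto_eLpNorm hp h.aestronglyMeasurable
    h.tendsto_eLpNorm a b
  simp only [h.integral_smul_sub_sub hp] at hzero
  have hslope := ((hasDerivAt_iff_tendsto_slope_zero.mp hb).sub
    (hasDerivAt_iff_tendsto_slope_zero.mp ha)).sub_const (∫ x in a..b, u' x)
  exact sub_eq_zero.mp (tendsto_nhds_unique hslope hzero)

variable [CompleteSpace E]

theorem HasLpDeriv.exists_ae_eq_add_integral (h : HasLpDeriv p u u') (hp : 1 ≤ p) :
    ∃ a, u =ᵐ[volume] fun b => u a + ∫ x in a..b, u' x := by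
  have hlebesgue := LocallyIntegrable.ae_hasDerivAt_integral (h.memLp.locallyIntegrable hp)
  obtain ⟨a, ha⟩ := hlebesgue.exists
  refine ⟨a, ?_⟩
  filter_upwards [hlebesgue] with b hb
  rw [← h.sub_eq_integral hp (ha 0) (hb 0), add_sub_cancel]

theorem exists_hasDerivAt_of_hasLpDeriv {v : ℕ → ℝ → E} (hp : 1 ≤ p)
    (hv : ∀ k, HasLpDeriv p (v k) (v (k + 1))) :
    ∃ w : ℕ → ℝ → E, (∀ k, w k =ᵐ[volume] v k) ∧ ∀ k t, HasDerivAt (w k) (w (k + 1) t) t := by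
  choose a ha using fun k => (hv k).exists_ae_eq_add_integral hp
  let w (k : ℕ) (b : ℝ) : E := v k (a k) + ∫ x in (a k)..b, v (k + 1) x
  have hwv (k : ℕ) : w k =ᵐ[volume] v k := (ha k).symm
  have hcont (k : ℕ) : Continuous (w k) :=
    continuous_const.add (intervalIntegral.continuous_primitive
      (intervalIntegrable_of_locallyIntegrable ((hv (k + 1)).memLp.locallyIntegrable hp)) _)
  refine ⟨w, hwv, fun k t => ?_⟩
  have hprim : w k = fun b => v k (a k) + ∫ x in (a k)..b, w (k + 1) x := funext fun b =>
    congrArg (v k (a k) + ·) (intervalIntegral.integral_congr_ae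
      ((hwv (k + 1)).mono fun x hx _ => hx.symm))
  rw [hprim]
  exact ((hcont (k + 1)).integral_hasStrictDerivAt (a k) t).hasDerivAt.const_add _

theorem enorm_le_eLpNorm_add_eLpNorm (hp : 1 ≤ p) (hu : ∀ t, HasDerivAt u (u' t) t)
    (hu' : Continuous u') (t : ℝ) : ‖u t‖ₑ ≤ eLpNorm u p + eLpNorm u' p := by
  have huc : Continuous u := continuous_iff_continuousAt.mpr fun t => (hu t).continuousAt
  have hunit {f : ℝ → E} (hf : Continuous f) : ∫⁻ s in uIoc t (t + 1), ‖f s‖ₑ ≤ eLpNorm f p := by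
    simpa using lintegral_uIoc_enorm_le_eLpNorm hp hf.aestronglyMeasurable t (t + 1)
  have hparts : u t = ∫ s in t..(t + 1), (u s - (t + 1 - s) • u' s) := by
    have hderiv (s : ℝ) :
        HasDerivAt (fun s => -((t + 1 - s) • u s)) (u s - (t + 1 - s) • u' s) s := by
      refine ((((hasDerivAt_id s).const_sub (t + 1)).smul (hu s)).neg).congr_deriv ?_
      simp only [id]
      module
    rw [intervalIntegral.integral_eq_sub_of_hasDerivAt (fun s _ => hderiv s)
      ((by fun_prop : Continuous _).intervalIntegrable _ _)]
    simp
  calc ‖u t‖ₑ ≤ ∫⁻ s in uIoc t (t + 1), ‖u s - (t + 1 - s) • u' s‖ₑ := by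
        rw [hparts, intervalIntegral.integral_of_le (by linarith), uIoc_of_le (by linarith)]
        exact enorm_integral_le_lintegral_enorm _
    _ ≤ ∫⁻ s in uIoc t (t + 1), (‖u s‖ₑ + ‖u' s‖ₑ) := by
        refine setLIntegral_mono' measurableSet_uIoc fun s hs => enorm_sub_le.trans ?_
        gcongr
        rw [uIoc_of_le (by linarith)] at hs
        rw [enorm_smul]
        refine mul_le_of_le_one_left' ?_
        rw [Real.enorm_eq_ofReal (by linarith [hs.2]), ENNReal.ofReal_le_one]
        linarith [hs.1]
    _ = (∫⁻ s in uIoc t (t + 1), ‖u s‖ₑ) + ∫⁻ s in uIoc t (t + 1), ‖u' s‖ₑ :=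
        lintegral_add_left huc.enorm.measurable _
    _ ≤ _ := add_le_add (hunit huc) (hunit hu')

theorem exists_expTypeBound_of_hasLpDeriv {v : ℕ → ℝ → E} {σ : ℝ} (hσ : 0 ≤ σ) (hp : 1 ≤ p)
    (hv : ∀ k, HasLpDeriv p (v k) (v (k + 1)))
    (hle : ∀ k, eLpNorm (v k) p ≤ ENNReal.ofReal (σ ^ k) * eLpNorm (v 0) p) :
    ∃ (u : ℝ → E) (M : ℝ), ExpTypeBound σ (fun _ => M) u ∧ u =ᵐ[volume] v 0 := by
  obtain ⟨w, hwv, hw⟩ := exists_hasDerivAt_of_hasLpDeriv hp hv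
  have hcont (k : ℕ) : Continuous (w k) :=
    continuous_iff_continuousAt.mpr fun t => (hw k t).continuousAt
  let N := (eLpNorm (v 0) p).toNNReal
  have hN : (N : ℝ≥0∞) = eLpNorm (v 0) p := ENNReal.coe_toNNReal (hv 0).memLp.2.ne
  have hwN (k : ℕ) : eLpNorm (w k) p ≤ ENNReal.ofReal (σ ^ k * N) := by
    rw [eLpNorm_congr_ae (hwv k), ENNReal.ofReal_mul (by positivity), ENNReal.ofReal_coe_nnreal, hN]
    exact hle k
  refine ⟨w 0, (1 + σ) * N, .of_hasDerivAt hw fun k t => ?_, hwv 0⟩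
  have h : ‖w k t‖ₑ ≤ ENNReal.ofReal (σ ^ k * N + σ ^ (k + 1) * N) := by
    rw [ENNReal.ofReal_add (by positivity) (by positivity)]
    exact (enorm_le_eLpNorm_add_eLpNorm hp (hw k) (hcont (k + 1)) t).trans
      (add_le_add (hwN k) (hwN (k + 1)))
  rw [← ofReal_norm, ENNReal.ofReal_le_ofReal_iff (by positivity)] at h
  exact h.trans_eq (by ring)

end LpDerivative

section LogarithmicVariable

theorem lintegral_halfLine (φ : ℝ → ℝ≥0∞) :
    ∫⁻ x, φ x ∂halfLine = ∫⁻ t, ENNReal.ofReal (Real.exp t) * φ (Real.exp t) := by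
  rw [halfLine, ← Real.range_exp, ← image_univ,
    lintegral_image_eq_lintegral_abs_deriv_mul MeasurableSet.univ
      (fun x _ => (Real.hasDerivAt_exp x).hasDerivWithinAt) Real.exp_injective.injOn,
    Measure.restrict_univ]
  simp only [Real.abs_exp]

theorem halfLine_eq_zero_iff {s : Set ℝ} (hs : MeasurableSet s) :
    halfLine s = 0 ↔ volume (Real.exp ⁻¹' s) = 0 := by
  have hm : Measurable fun t => ENNReal.ofReal (Real.exp t) * s.indicator 1 (Real.exp t) :=
    Real.measurable_exp.ennreal_ofReal.mul
      ((measurable_one.indicator hs).comp Real.measurable_exp)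
  rw [← lintegral_indicator_one hs, lintegral_halfLine, lintegral_eq_zero_iff hm, EventuallyEq,
    ae_iff]
  congr! 2
  ext t
  simp [Real.exp_pos]

theorem quasiMeasurePreserving_exp :
    Measure.QuasiMeasurePreserving Real.exp volume halfLine := by
  refine ⟨Real.measurable_exp, .mk fun s hs h => ?_⟩
  rw [Measure.map_apply Real.measurable_exp hs]
  exact (halfLine_eq_zero_iff hs).mp h

theorem quasiMeasurePreserving_log :
    Measure.QuasiMeasurePreserving Real.log halfLine volume := by
  refine ⟨Real.measurable_log, .mk fun s hs h => ?_⟩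
  rw [Measure.map_apply Real.measurable_log hs, halfLine_eq_zero_iff (Real.measurable_log hs),
    ← preimage_comp]
  simpa only [Function.comp_def, Real.log_exp, preimage_id'] using h

variable {p : ℝ} {f g : ℝ → ℂ}

theorem xNorm_eq_eLpNorm (hp : 0 < p) (f : ℝ → ℂ) :
    xNorm p f = eLpNorm (fun t => f (Real.exp t)) (ENNReal.ofReal p) := by
  have hp0 : ENNReal.ofReal p ≠ 0 := by simpa using hp
  have hweight (t : ℝ) :
      ‖((Real.exp t ^ (-1 / p) : ℝ) : ℂ)‖ₑ ^ p = ENNReal.ofReal (Real.exp (-t)) := by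
    rw [← ofReal_norm, Complex.norm_real, Real.norm_of_nonneg (by positivity),
      ENNReal.ofReal_rpow_of_nonneg (by positivity) hp.le, ← Real.exp_mul, ← Real.exp_mul]
    congr 2
    field_simp
  rw [xNorm, eLpNorm_eq_lintegral_rpow_enorm_toReal hp0 ENNReal.ofReal_ne_top,
    eLpNorm_eq_lintegral_rpow_enorm_toReal hp0 ENNReal.ofReal_ne_top,
    ENNReal.toReal_ofReal hp.le, lintegral_halfLine]
  congr 1
  refine lintegral_congr fun t => ?_
  rw [weighted, enorm_mul, ENNReal.mul_rpow_of_nonneg _ _ hp.le, hweight, ← mul_assoc,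
    ← ENNReal.ofReal_mul (Real.exp_pos t).le, ← Real.exp_add]
  simp

theorem MemX.memLp_comp_exp (hp : 0 < p) (hf : MemX p f) :
    MemLp (fun t => f (Real.exp t)) (ENNReal.ofReal p) := by
  refine ⟨?_, xNorm_eq_eLpNorm hp f ▸ hf.2⟩
  have hweighted := hf.1.comp_quasiMeasurePreserving quasiMeasurePreserving_exp
  have hweight : AEStronglyMeasurable (fun t : ℝ => ((Real.exp t ^ (1 / p) : ℝ) : ℂ)) :=
    Measurable.aestronglyMeasurable (by fun_prop)
  refine (hweight.mul hweighted).congr (.of_forall fun t => ?_)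
  simp only [Pi.mul_apply, Function.comp_apply, weighted]
  rw [← mul_assoc, ← Complex.ofReal_mul, ← Real.rpow_add (Real.exp_pos t), ← add_div,
    add_neg_cancel, zero_div, Real.rpow_zero, Complex.ofReal_one, one_mul]

theorem IsTheta.hasLpDeriv (hp : 0 < p) (h : IsTheta p f g) :
    HasLpDeriv (ENNReal.ofReal p) (fun t => f (Real.exp t)) (fun t => g (Real.exp t)) where
  memLp := h.1.memLp_comp_exp hp
  memLp_deriv := h.2.1.memLp_comp_exp hp
  tendsto_eLpNorm := by
    refine h.2.2.congr fun t => ?_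
    simp only [xNorm_eq_eLpNorm hp, translate, Real.exp_add, div_eq_inv_mul, Complex.real_smul,
      Complex.ofReal_inv]

theorem exists_expTypeBound_comp_exp_of_mem_bernstein {σ : ℝ} (hσ : 0 ≤ σ) (hp : 1 ≤ p)
    (hf : f ∈ bernstein σ p) :
    ∃ (F : ℝ → ℂ) (M : ℝ), ExpTypeBound σ (fun _ => M) (fun t => F (Real.exp t)) ∧
      F =ᵐ[halfLine] f := by
  have hp0 : 0 < p := by linarith
  obtain ⟨g, rfl, hg, hle⟩ := hf
  simp only [xNorm_eq_eLpNorm hp0] at hle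
  obtain ⟨h, M, hh, hhg⟩ := exists_expTypeBound_of_hasLpDeriv hσ (ENNReal.one_le_ofReal.mpr hp)
    (fun k => (hg k).hasLpDeriv hp0) hle
  refine ⟨fun x => h (Real.log x), M, by simpa only [Real.log_exp] using hh, ?_⟩
  filter_upwards [quasiMeasurePreserving_log.ae hhg, ae_restrict_mem measurableSet_Ioi]
    with x hx hx0
  rw [hx, Real.exp_log hx0]

variable {E : Type*} [NormedAddCommGroup E] [NormedSpace ℝ E] {G : ℝ → E}

theorem contDiffOn_Ioi_of_contDiff_comp_exp {n : WithTop ℕ∞}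
    (hG : ContDiff ℝ n fun t => G (Real.exp t)) : ContDiffOn ℝ n G (Ioi 0) :=
  (hG.comp_contDiffOn (Real.contDiffOn_log.mono fun _ hx => ne_of_gt hx)).congr
    fun x hx => by simp only [Function.comp_apply, Real.exp_log hx]

theorem deriv_comp_exp_zero (hG : DifferentiableAt ℝ G 1) :
    deriv (fun t => G (Real.exp t)) 0 = deriv G 1 := by
  have hG' : HasDerivAt G (deriv G 1) (Real.exp 0) := by simpa using hG.hasDerivAt
  simpa [Function.comp_def] using (hG'.scomp 0 (Real.hasDerivAt_exp 0)).deriv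

end LogarithmicVariable

section SamplingSeries

variable {σ M : ℝ} {F : ℝ → ℂ}

theorem vtTerm_eq_samplingCoeff_smul (σ : ℝ) (F : ℝ → ℂ) (k : {k : ℤ // k ≠ 0}) (τ : ℝ) :
    vtTerm σ F k τ = samplingCoeff (σ / Real.pi * Real.log τ) k •
      F (Real.exp ((k : ℤ) * Real.pi / σ)) := by
  rw [vtTerm, samplingCoeff_of_ne_zero _ k.2, Complex.real_smul, mul_comm]
  congr 3
  ring

theorem norm_vtTerm_le (hF : ∀ t, ‖F (Real.exp t)‖ ≤ M) {τ R : ℝ}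
    (hR : |σ / Real.pi * Real.log τ| ≤ R) (k : {k : ℤ // k ≠ 0}) :
    ‖vtTerm σ F k τ‖ ≤ R * (1 + R) * (1 / ((k : ℤ) : ℝ) ^ 2) * M := by
  have hR0 : 0 ≤ R := (abs_nonneg _).trans hR
  rw [vtTerm_eq_samplingCoeff_smul, norm_smul, Real.norm_eq_abs, samplingCoeff_of_ne_zero _ k.2]
  refine mul_le_mul ((abs_div_mul_nsinc_sub_le _ (mod_cast k.2)).trans ?_) (hF _) (norm_nonneg _)
    (by positivity)
  gcongr

theorem summable_const_mul_one_div_sq_mul_const (R M : ℝ) :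
    Summable fun k : {k : ℤ // k ≠ 0} => R * (1 / ((k : ℤ) : ℝ) ^ 2) * M :=
  (((Real.summable_one_div_int_pow.mpr one_lt_two).subtype _).mul_left R).mul_right M

theorem summable_norm_vtTerm (hF : ∀ t, ‖F (Real.exp t)‖ ≤ M) (τ : ℝ) :
    Summable fun k => ‖vtTerm σ F k τ‖ :=
  .of_nonneg_of_le (fun _ => norm_nonneg _) (norm_vtTerm_le hF le_rfl)
    (summable_const_mul_one_div_sq_mul_const _ M)

theorem exists_summable_forall_norm_vtTerm_le (σ : ℝ) (hF : ∀ t, ‖F (Real.exp t)‖ ≤ M) {K : Set ℝ}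
    (hK : K ⊆ Ioi 0) (hKc : IsCompact K) :
    ∃ b : {k : ℤ // k ≠ 0} → ℝ, Summable b ∧ ∀ k, ∀ τ ∈ K, ‖vtTerm σ F k τ‖ ≤ b k := by
  obtain ⟨R, hR⟩ := hKc.exists_bound_of_continuousOn (f := fun τ => σ / Real.pi * Real.log τ)
    (continuousOn_const.mul (Real.continuousOn_log.mono fun x hx => ne_of_gt (hK hx)))
  exact ⟨_, summable_const_mul_one_div_sq_mul_const (R * (1 + R)) M,
    fun k τ hτ => norm_vtTerm_le hF (hR τ hτ) k⟩

theorem ExpTypeBound.eq_add_tsum_vtTerm (hσ : 0 < σ)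
    (hF : ExpTypeBound σ (fun _ => M) fun t => F (Real.exp t)) {τ : ℝ} (hτ : 0 < τ) :
    F τ = (nsinc (σ / Real.pi * Real.log τ) : ℂ) * F 1
      + ((Real.log τ * nsinc (σ / Real.pi * Real.log τ) : ℝ) : ℂ) * deriv F 1
      + ∑' k, vtTerm σ F k τ := by
  have hdiff : DifferentiableAt ℝ F 1 :=
    ((contDiffOn_Ioi_of_contDiff_comp_exp hF.contDiff).contDiffAt
      (Ioi_mem_nhds one_pos)).differentiableAt (by simp)
  have hseries := hF.hasSum_samplingCoeff_smul_of_pos hσ (Real.log τ)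
  rw [Real.exp_log hτ, deriv_comp_exp_zero hdiff] at hseries
  have hsplit := hseries.summable.tsum_subtype_add_tsum_subtype_compl {0}
  rw [hseries.tsum_eq, tsum_singleton (0 : ℤ)
    (fun k : ℤ => samplingCoeff _ k • F (Real.exp (k * Real.pi / σ)))] at hsplit
  have hterms : ∑' k, vtTerm σ F k τ = ∑' k : ({0}ᶜ : Set ℤ),
      samplingCoeff (σ / Real.pi * Real.log τ) k • F (Real.exp ((k : ℤ) * Real.pi / σ)) :=
    tsum_congr fun k => vtTerm_eq_samplingCoeff_smul σ F k τ
  rw [← hterms] at hsplit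
  simp only [samplingCoeff_zero, Int.cast_zero, zero_mul, zero_div, Real.exp_zero,
    Complex.real_smul] at hsplit
  linear_combination -hsplit

end SamplingSeries

end Mellin

theorem mainTheorem4_general (σ p : ℝ) (hσ : 0 < σ) (hp : 1 ≤ p) (f : ℝ → ℂ)
    (hf : f ∈ Mellin.bernstein σ p) :
    (∃ F : ℝ → ℂ, ContinuousOn F (Ioi 0) ∧ F =ᵐ[Mellin.halfLine] f) ∧
    ∀ F : ℝ → ℂ, ContinuousOn F (Ioi 0) → F =ᵐ[Mellin.halfLine] f →
      ContDiffOn ℝ ∞ F (Ioi 0) ∧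
      (∀ τ : ℝ, 0 < τ →
        Summable (fun k => ‖Mellin.vtTerm σ F k τ‖) ∧
        F τ = (Mellin.nsinc (σ / Real.pi * Real.log τ) : ℂ) * F 1
          + ((Real.log τ * Mellin.nsinc (σ / Real.pi * Real.log τ) : ℝ) : ℂ) * deriv F 1
          + ∑' k, Mellin.vtTerm σ F k τ) ∧
      (∀ K : Set ℝ, K ⊆ Ioi 0 → IsCompact K →
        HasSumUniformlyOn (Mellin.vtTerm σ F) (fun τ => ∑' k, Mellin.vtTerm σ F k τ) K ∧
        HasSumUniformlyOn (fun k τ => ‖Mellin.vtTerm σ F k τ‖)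
          (fun τ => ∑' k, ‖Mellin.vtTerm σ F k τ‖) K) := by
  obtain ⟨G, M, hG, hGf⟩ := Mellin.exists_expTypeBound_comp_exp_of_mem_bernstein hσ.le hp hf
  have hGc := (Mellin.contDiffOn_Ioi_of_contDiff_comp_exp hG.contDiff).continuousOn
  refine ⟨⟨G, hGc, hGf⟩, fun F hFc hFf => ?_⟩
  have hFG : EqOn F G (Ioi 0) :=
    Measure.eqOn_open_of_ae_eq (hFf.trans hGf.symm) isOpen_Ioi hFc hGc
  have hF : Mellin.ExpTypeBound σ (fun _ => M) fun t => F (Real.exp t) := by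
    simpa only [hFG (Real.exp_pos _)] using hG
  refine ⟨Mellin.contDiffOn_Ioi_of_contDiff_comp_exp hF.contDiff, fun τ hτ =>
    ⟨Mellin.summable_norm_vtTerm hF.norm_le τ, hF.eq_add_tsum_vtTerm hσ hτ⟩, fun K hK hKc => ?_⟩
  obtain ⟨b, hb, hle⟩ := Mellin.exists_summable_forall_norm_vtTerm_le σ hF.norm_le hK hKc
  exact ⟨.of_norm_le_summable hb hle,
    .of_norm_le_summable hb fun k τ hτ => (norm_norm _).trans_le (hle k τ hτ)⟩

theorem mainTheorem4 (σ p : ℝ) (hσ : 0 < σ) (hp : 1 < p) (f : ℝ → ℂ)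
    (hf : f ∈ Mellin.bernstein σ p) :
    (∃ F : ℝ → ℂ, ContinuousOn F (Ioi 0) ∧ F =ᵐ[Mellin.halfLine] f) ∧
    ∀ F : ℝ → ℂ, ContinuousOn F (Ioi 0) → F =ᵐ[Mellin.halfLine] f →
      ContDiffOn ℝ ∞ F (Ioi 0) ∧
      (∀ τ : ℝ, 0 < τ →
        Summable (fun k => ‖Mellin.vtTerm σ F k τ‖) ∧
        F τ = (Mellin.nsinc (σ / Real.pi * Real.log τ) : ℂ) * F 1
          + ((Real.log τ * Mellin.nsinc (σ / Real.pi * Real.log τ) : ℝ) : ℂ) * deriv F 1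
          + ∑' k, Mellin.vtTerm σ F k τ) ∧
      (∀ K : Set ℝ, K ⊆ Ioi 0 → IsCompact K →
        HasSumUniformlyOn (Mellin.vtTerm σ F) (fun τ => ∑' k, Mellin.vtTerm σ F k τ) K ∧
        HasSumUniformlyOn (fun k τ => ‖Mellin.vtTerm σ F k τ‖)
          (fun τ => ∑' k, ‖Mellin.vtTerm σ F k τ‖) K) :=
  mainTheorem4_general σ p hσ hp.le f hf
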